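/- A one-state Turing machine $M$ is given by a finite input alphabet $\Sigma$, a finite tape alphabet $\Gamma\supseteq\Sigma$ containing a blank symbol $\sqcup\notin\Sigma$, a set $H\subseteq\Gamma$ of halting symbols, and a transition function $\delta:\Gamma\setminus H\to\Gamma\times\{L,R\}$. Its tape is infinite in both directions. On input $x\in\Sigma^*$ the tape initially contains $x$ and is blank elsewhere, and the head is on the leftmost symbol of $x$ (on a blank cell if $x$ is empty). If the symbol $a$ under the head is in $H$, then $M$ halts; otherwise, with $\delta(a)=(b,D)$, it replaces $a$ by $b$ and moves the head one cell in direction $D$. The language recognized by $M$ is $L(M)=\{x\in\Sigma^* \mid M \text{ halts on input } x\}$. Let $R$ be the class of regular languages over finite alphabets, $CF$ the class of context-free languages over finite alphabets, and $TM_{1state}$ the class of languages recognized by one-state Turing machines. Then $$R\not\subseteq TM_{1state}\qquad\text{and}\qquad TM_{1state}\not\subseteq CF.$$ That is, some regular language is not recognized by any one-state Turing machine, and some one-state Turing machine recognizes a language that is not context-free. -/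

import Mathlib

/-- A one-state Turing machine with input alphabet `S`. The unique state carries no information and
is left implicit. -/
structure OneStateTM (S : Type) where
  /-- The tape alphabet, a finite set. -/
  Γ : Type
  [finite : Finite Γ]
  /-- The blank symbol. -/
  blank : Γ
  /-- The inclusion of the input alphabet in the tape alphabet. -/
  input : S ↪ Γ
  /-- The blank is not an input symbol. -/
  input_ne_blank : ∀ s, input s ≠ blank
  /-- The halting symbols. -/
  H : Set Γ
  /-- The transition function, defined on the non-halting symbols: the symbol that is written and
  the direction of the move. -/
  δ : {a : Γ // a ∉ H} → Γ × Turing.Dir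

namespace OneStateTM

variable {S : Type} (M : OneStateTM S)

/-- A configuration: a tape that is infinite in both directions, and the head position. -/
structure Cfg where
  tape : ℤ → M.Γ
  head : ℤ

/-- The initial configuration: the input is written on the cells `0, 1, …, w.length - 1`, all other
cells are blank, and the head is on the cell `0`. -/
def init (w : List S) : M.Cfg where
  tape
    | Int.ofNat n => (w[n]?).elim M.blank M.input
    | Int.negSucc _ => M.blank
  head := 0

/-- The position next to `i` in the given direction. -/
def move (i : ℤ) : Turing.Dir → ℤ
  | Turing.Dir.left => i - 1
  | Turing.Dir.right => i + 1

/-- `M.Step c c'`: the symbol under the head in `c` is not a halting symbol, and `c'` is the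
configuration after one application of the transition function. -/
def Step (c c' : M.Cfg) : Prop :=
  ∃ h : c.tape c.head ∉ M.H,
    c' = { tape := Function.update c.tape c.head (M.δ ⟨c.tape c.head, h⟩).1
           head := move c.head (M.δ ⟨c.tape c.head, h⟩).2 }

/-- `M` halts on the input `w`: after finitely many steps the head is on a halting symbol. -/
def HaltsOn (w : List S) : Prop :=
  ∃ c : M.Cfg, Relation.ReflTransGen M.Step (M.init w) c ∧ c.tape c.head ∈ M.H

/-- The language recognized by `M`. -/
def language : Language S := {w | M.HaltsOn w}

end OneStateTM

/-- A formal language: a finite alphabet together with a set of words over it. -/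
structure FormalLanguage : Type 1 where
  alphabet : Type
  [finite : Finite alphabet]
  words : Language alphabet

/-- The class `R` of regular languages. -/
def classR : Set FormalLanguage := {L | L.words.IsRegular}

/-- The class `CF` of context-free languages. -/
def classCF : Set FormalLanguage := {L | L.words.IsContextFree}

/-- The class of languages recognized by one-state Turing machines. -/
def classTM1state : Set FormalLanguage :=
  {L | ∃ M : OneStateTM L.alphabet, M.language = L.words}

/-! Regular but not one-state: the even-length words over one letter. A machine that halts on the
empty word must treat the blank as halting, since otherwise it runs over fresh blanks in one
direction forever (`blank_mem_of_haltsOn_nil`). But then it also halts on a one-letter word, because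
both neighbours of the letter are blank (`haltsOn_singleton`).

One-state but not context-free: a machine can let symbols on the tape play the role of states and
run an `n`-digit binary counter, one increment per unit (`count_up`). It halts with `2 ^ n - 1`
units and overflows with `2 ^ n` or more. Pumping extra units causes an overflow; removing a digit
halves the capacity, while the pumping lemma removes only boundedly many units. -/

namespace ContextFreeGrammar

/-! ### Parse forests and the pumping lemma for context-free grammars -/

variable {T : Type*} (g : ContextFreeGrammar T)

/-- `g.Yields s w`: the word `w` is the yield of a forest of parse trees with roots `s`. -/
inductive Yields : List (Symbol T g.NT) → List T → Prop
  | nil : Yields [] []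
  | terminal (t : T) {s : List (Symbol T g.NT)} {w : List T} (h : Yields s w) :
      Yields (.terminal t :: s) (t :: w)
  | nonterminal (r : ContextFreeRule T g.NT) (hr : r ∈ g.rules) {s : List (Symbol T g.NT)}
      {u w : List T} (hu : Yields r.output u) (hw : Yields s w) :
      Yields (.nonterminal r.input :: s) (u ++ w)

variable {g}

theorem Yields.map_terminal (w : List T) : g.Yields (w.map .terminal) w := by
  induction w with
  | nil => exact .nil
  | cons t w ih => exact .terminal t ih

theorem Yields.exists_of_append {s t : List (Symbol T g.NT)} {w : List T}
    (h : g.Yields (s ++ t) w) : ∃ u v, w = u ++ v ∧ g.Yields s u ∧ g.Yields t v := by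
  induction s generalizing w with
  | nil => exact ⟨[], w, rfl, .nil, h⟩
  | cons x s ih =>
    cases h with
    | terminal a h =>
      obtain ⟨u, v, rfl, hu, hv⟩ := ih h
      exact ⟨a :: u, v, rfl, .terminal a hu, hv⟩
    | nonterminal r hr hu hw =>
      obtain ⟨u', v, rfl, hu', hv⟩ := ih hw
      exact ⟨_ ++ u', v, by simp, .nonterminal r hr hu hu', hv⟩

/-- The trees over the output of `r` are joined under a new root; all other trees are kept. Iterated
backwards from the terminal word, this turns a derivation into a forest. -/
theorem Yields.of_rewrites {r : ContextFreeRule T g.NT} (hr : r ∈ g.rules)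
    {s t : List (Symbol T g.NT)} (hst : r.Rewrites s t) {w : List T} (h : g.Yields t w) :
    g.Yields s w := by
  induction hst generalizing w with
  | head s =>
    obtain ⟨u, v, rfl, hu, hv⟩ := h.exists_of_append
    exact .nonterminal r hr hu hv
  | cons x _ ih =>
    cases h with
    | terminal a h => exact .terminal a (ih h)
    | nonterminal r' hr' hu hw => exact .nonterminal r' hr' hu (ih hw)

theorem Derives.yields {s : List (Symbol T g.NT)} {w : List T}
    (h : g.Derives s (w.map .terminal)) : g.Yields s w := by
  induction h using Relation.ReflTransGen.head_induction_on with
  | refl => exact .map_terminal w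
  | head h _ ih =>
    obtain ⟨r, hr, h⟩ := h
    exact ih.of_rewrites hr h

theorem derives_output {r : ContextFreeRule T g.NT} (hr : r ∈ g.rules) :
    g.Derives [.nonterminal r.input] r.output :=
  .single ⟨r, hr, ContextFreeRule.Rewrites.input_output⟩

theorem Derives.append {s s' t t' : List (Symbol T g.NT)} (hs : g.Derives s s')
    (ht : g.Derives t t') : g.Derives (s ++ t) (s' ++ t') :=
  (Derives.append_right hs t).trans (Derives.append_left ht s')

theorem Yields.derives {s : List (Symbol T g.NT)} {w : List T} (h : g.Yields s w) :
    g.Derives s (w.map .terminal) := by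
  induction h with
  | nil => exact .refl _
  | terminal t _ ih => exact Derives.append_left ih [.terminal t]
  | nonterminal r hr _ _ ihu ihw =>
    rw [List.map_append]
    exact Derives.append ((derives_output hr).trans ihu) ihw

/-- `g.Occurs s w B x`: in some derivation of the word `w` from `s`, the nonterminal `B` occurs and
the subword `x` is derived from that occurrence. -/
def Occurs (g : ContextFreeGrammar T) (s : List (Symbol T g.NT)) (w : List T) (B : g.NT)
    (x : List T) : Prop :=
  ∃ v y, w = v ++ x ++ y ∧
    g.Derives s (v.map .terminal ++ [.nonterminal B] ++ y.map .terminal) ∧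
    g.Derives [.nonterminal B] (x.map .terminal)

theorem Occurs.lift {s t : List (Symbol T g.NT)} {p q w x : List T} {B : g.NT}
    (h : g.Derives t (p.map .terminal ++ s ++ q.map .terminal)) (hs : g.Occurs s w B x) :
    g.Occurs t (p ++ w ++ q) B x := by
  obtain ⟨v, y, rfl, hd, hx⟩ := hs
  refine ⟨p ++ v, y ++ q, by simp, h.trans ?_, hx⟩
  simpa using Derives.append_right (Derives.append_left hd (p.map .terminal)) (q.map .terminal)

/-- `g.Pumps K s w`: some derivation of `w` from `s` has a nonempty loop `B ⇒* v B y` with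
`B ⇒* x`, above a subword `v ++ x ++ y` of length at most `K`. -/
def Pumps (g : ContextFreeGrammar T) (K : ℕ) (s : List (Symbol T g.NT)) (w : List T) : Prop :=
  ∃ B v x y, v ++ y ≠ [] ∧ (v ++ x ++ y).length ≤ K ∧ g.Occurs s w B (v ++ x ++ y) ∧
    g.Derives [.nonterminal B] (v.map .terminal ++ [.nonterminal B] ++ y.map .terminal) ∧
    g.Derives [.nonterminal B] (x.map .terminal)

/-- Either there is a loop, or there are `j` distinct nonterminals deriving short subwords. -/
def PumpsOr (g : ContextFreeGrammar T) (K m j : ℕ) (s : List (Symbol T g.NT)) (w : List T) :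
    Prop :=
  g.Pumps K s w ∨ ∃ S : Finset g.NT, S.card = j ∧ ∀ B ∈ S, (∃ r ∈ g.rules, r.input = B) ∧
    ∃ x, x.length ≤ m ^ (j + 1) ∧ g.Occurs s w B x

theorem Pumps.lift {K : ℕ} {s t : List (Symbol T g.NT)} {p q w : List T}
    (h : g.Derives t (p.map .terminal ++ s ++ q.map .terminal)) (hs : g.Pumps K s w) :
    g.Pumps K t (p ++ w ++ q) := by
  obtain ⟨B, v, x, y, h1, h2, h3, h4⟩ := hs
  exact ⟨B, v, x, y, h1, h2, h3.lift h, h4⟩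

theorem PumpsOr.lift {K m j : ℕ} {s t : List (Symbol T g.NT)} {p q w : List T}
    (h : g.Derives t (p.map .terminal ++ s ++ q.map .terminal)) (hs : g.PumpsOr K m j s w) :
    g.PumpsOr K m j t (p ++ w ++ q) := by
  rcases hs with hs | ⟨S, hS, H⟩
  · exact .inl (hs.lift h)
  · refine .inr ⟨S, hS, fun B hB => ⟨(H B hB).1, ?_⟩⟩
    obtain ⟨x, hx, ho⟩ := (H B hB).2
    exact ⟨x, hx, ho.lift h⟩

/-- Descend to a lowest node whose yield `u` is longer than `m ^ (j + 1)`; having at most `m`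
children, it satisfies `u.length ≤ m ^ (j + 2)`. The hypothesis `ih` for its children gives a loop
or `j` nonterminals below it. The label of the node is either a new nonterminal or repeats one of
them, which closes a loop. -/
theorem Yields.pumpsOr_succ {K m j : ℕ} (hm : ∀ r ∈ g.rules, r.output.length ≤ m)
    (hm0 : 0 < m) (hK : m ^ (j + 2) ≤ K)
    (ih : ∀ {s : List (Symbol T g.NT)} {w : List T}, g.Yields s w →
      s.length * m ^ j < w.length → g.PumpsOr K m j s w)
    {s : List (Symbol T g.NT)} {w : List T} (h : g.Yields s w)
    (hl : s.length * m ^ (j + 1) < w.length) : g.PumpsOr K m (j + 1) s w := by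
  classical
  induction h with
  | nil => simp at hl
  | @terminal t s w h ih' =>
    have h1 : 0 < m ^ (j + 1) := by positivity
    have h2 := ih' (by simp only [List.length_cons, add_mul] at hl; omega)
    simpa using h2.lift (t := .terminal t :: s) (p := [t]) (q := []) (by simpa using Derives.refl _)
  | @nonterminal r hr s u w hu hw ihu ihw =>
    have hout : g.Derives (.nonterminal r.input :: s)
        (([] : List T).map .terminal ++ r.output ++ w.map .terminal) := by
      simpa using Derives.append (derives_output hr) hw.derives
    by_cases h1 : s.length * m ^ (j + 1) < w.length
    · simpa using (ihw h1).lift (t := .nonterminal r.input :: s) (p := u) (q := []) (by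
        simpa using Derives.append_right ((derives_output hr).trans hu.derives) s)
    by_cases h2 : r.output.length * m ^ (j + 1) < u.length
    · exact (ihu h2).lift (p := []) (q := w) hout
    have h3 : m ^ (j + 1) < u.length := by
      simp only [List.length_cons, List.length_append, add_mul] at hl; omega
    have h4 : u.length ≤ m ^ (j + 2) := by
      have := Nat.mul_le_mul_right (m ^ (j + 1)) (hm r hr)
      rw [pow_succ m (j + 1), mul_comm]; omega
    have h5 : r.output.length * m ^ j < u.length := by
      have := Nat.mul_le_mul_right (m ^ j) (hm r hr)
      rw [pow_succ, mul_comm] at h3; omega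
    rcases ih hu h5 with hp | ⟨S, hS, H⟩
    · exact .inl (hp.lift (p := []) (q := w) hout)
    have hocc : g.Occurs (.nonterminal r.input :: s) (u ++ w) r.input u :=
      ⟨[], w, by simp, by simpa using Derives.append_left hw.derives [.nonterminal r.input],
        (derives_output hr).trans hu.derives⟩
    by_cases hA : r.input ∈ S
    · obtain ⟨x, hx, v, y, rfl, hd, hdx⟩ := (H _ hA).2
      refine .inl ⟨r.input, v, x, y, ?_, h4.trans hK, hocc, (derives_output hr).trans hd, hdx⟩
      -- With `v` and `y` empty, `u = x` would have length at most `m ^ (j + 1)`.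
      intro h0
      simp only [List.append_eq_nil_iff] at h0
      simp [h0.1, h0.2] at h3
      omega
    · refine .inr ⟨insert r.input S, by rw [Finset.card_insert_of_notMem hA, hS], ?_⟩
      intro B hB
      rcases Finset.mem_insert.1 hB with rfl | hB
      · exact ⟨⟨r, hr, rfl⟩, u, h4, hocc⟩
      · obtain ⟨hBr, x, hx, ho⟩ := H B hB
        refine ⟨hBr, x, hx.trans (Nat.pow_le_pow_right hm0 (by omega)), ?_⟩
        exact ho.lift (p := []) (q := w) hout

theorem Yields.pumpsOr {K m j : ℕ} (hm : ∀ r ∈ g.rules, r.output.length ≤ m) (hm0 : 0 < m)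
    (hK : m ^ (j + 1) ≤ K) {s : List (Symbol T g.NT)} {w : List T} (h : g.Yields s w)
    (hl : s.length * m ^ j < w.length) : g.PumpsOr K m j s w := by
  induction j generalizing s w with
  | zero => exact .inr ⟨∅, by simp⟩
  | succ j ih =>
    exact h.pumpsOr_succ hm hm0 hK
      (ih ((Nat.pow_le_pow_right hm0 (by omega)).trans hK)) hl

theorem exists_pumps (g : ContextFreeGrammar T) :
    ∃ K, ∀ w ∈ g.language, K < w.length → g.Pumps K [.nonterminal g.initial] w := by
  classical
  let m := g.rules.sup (fun r => r.output.length) + 1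
  -- One more than the number of left-hand sides, so `N` distinct ones cannot exist.
  let N := (g.rules.image (·.input)).card + 1
  refine ⟨m ^ (N + 1), fun w hw hl => ?_⟩
  have hm : ∀ r ∈ g.rules, r.output.length ≤ m := fun r hr =>
    (Finset.le_sup (f := fun r : ContextFreeRule T g.NT => r.output.length) hr).trans
      (Nat.le_succ _)
  have hle : m ^ N ≤ m ^ (N + 1) := Nat.pow_le_pow_right (Nat.succ_pos _) (Nat.le_succ _)
  rcases (Derives.yields hw).pumpsOr (j := N) hm (Nat.succ_pos _) le_rfl
    (by simpa using hle.trans_lt hl) with h | ⟨S, hS, H⟩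
  · exact h
  · have hsub : S ⊆ g.rules.image (·.input) := fun B hB => Finset.mem_image.2 (H B hB).1
    have := Finset.card_le_card hsub
    omega

theorem derives_iterate {B : g.NT} {v y : List T}
    (h : g.Derives [.nonterminal B] (v.map .terminal ++ [.nonterminal B] ++ y.map .terminal))
    (i : ℕ) :
    g.Derives [.nonterminal B] ((List.replicate i v).flatten.map .terminal ++ [.nonterminal B] ++
      (List.replicate i y).flatten.map .terminal) := by
  induction i with
  | zero => simpa using Derives.refl _
  | succ i ih =>
    refine ih.trans ?_
    have := Derives.append_right (Derives.append_left h
      ((List.replicate i v).flatten.map .terminal)) ((List.replicate i y).flatten.map .terminal)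
    rw [List.replicate_succ' (a := v), List.replicate_succ (a := y)]
    simpa using this

end ContextFreeGrammar

/-- The pumping lemma for context-free languages. -/
theorem Language.IsContextFree.pumping {T : Type*} {L : Language T} (hL : L.IsContextFree) :
    ∃ K, ∀ w ∈ L, K < w.length → ∃ u v x y z, w = u ++ v ++ x ++ y ++ z ∧ v ++ y ≠ [] ∧
      (v ++ x ++ y).length ≤ K ∧
      ∀ i : ℕ, u ++ (List.replicate i v).flatten ++ x ++ (List.replicate i y).flatten ++ z ∈ L := by
  obtain ⟨g, rfl⟩ := hL
  obtain ⟨K, hK⟩ := g.exists_pumps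
  refine ⟨K, fun w hw hl => ?_⟩
  obtain ⟨B, v, x, y, h0, hlen, ⟨u, z, rfl, hd, -⟩, hloop, hx⟩ := hK w hw hl
  refine ⟨u, v, x, y, z, by simp, h0, hlen, fun i => ?_⟩
  have h1 := (ContextFreeGrammar.derives_iterate hloop i).trans
    (ContextFreeGrammar.Derives.append_right (ContextFreeGrammar.Derives.append_left hx _) _)
  have h2 := hd.trans
    (ContextFreeGrammar.Derives.append_right (ContextFreeGrammar.Derives.append_left h1 _) _)
  simpa [ContextFreeGrammar.mem_language_iff] using h2

/-! ### Runs of one-state machines -/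

namespace OneStateTM

section General

variable {S : Type} (M : OneStateTM S)

theorem Step.right_unique : Relator.RightUnique M.Step := by
  rintro c _ _ ⟨_, rfl⟩ ⟨_, rfl⟩
  rfl

/-- A computation that reaches a set of non-halting configurations closed under steps does not
halt. -/
theorem not_haltsOn_of_invariant {w : List S} (P : M.Cfg → Prop)
    (hstep : ∀ c c', P c → M.Step c c' → P c') (hhalt : ∀ c, P c → c.tape c.head ∉ M.H)
    {c : M.Cfg} (hc : Relation.ReflTransGen M.Step (M.init w) c) (hP : P c) :
    ¬ M.HaltsOn w := by
  rintro ⟨c', hc', hH⟩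
  -- By determinism one of the two configurations is reached from the other, and a halting one has
  -- no successor.
  rcases Relation.ReflTransGen.total_of_right_unique (Step.right_unique M) hc' hc with h | h
  · rcases h.cases_head with rfl | ⟨d, ⟨hd, -⟩, -⟩
    · exact hhalt _ hP hH
    · exact hd hH
  · have : P c' := by
      clear hH hc'
      induction h with
      | refl => exact hP
      | tail _ h ih => exact hstep _ _ ih h
    exact hhalt _ this hH

/-- The tape with the word `w` on the cells `0, 1, …, w.length - 1` and blanks elsewhere. -/
def tapeOf (w : List M.Γ) : ℤ → M.Γ
  | Int.ofNat n => (w[n]?).getD M.blank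
  | Int.negSucc _ => M.blank

/-- The word `l ++ r` is on the tape, and the head is on the cell that follows `l`. -/
def headAfter (l r : List M.Γ) : M.Cfg := ⟨M.tapeOf (l ++ r), l.length⟩

/-- The word `l ++ r` is on the tape, and the head is on the last cell of `l`. -/
def headBefore (l r : List M.Γ) : M.Cfg := ⟨M.tapeOf (l ++ r), l.length - 1⟩

theorem init_eq_headAfter (w : List S) : M.init w = M.headAfter [] (w.map M.input) := by
  unfold init headAfter
  congr 1
  ext i
  rcases i with n | n
  · simp only [tapeOf, List.nil_append, List.getElem?_map]
    cases w[n]? <;> rfl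
  · rfl

theorem headBefore_concat (l r : List M.Γ) (x : M.Γ) :
    M.headBefore (l ++ [x]) r = M.headAfter l (x :: r) := by
  simp [headBefore, headAfter]

theorem tapeOf_length (l r : List M.Γ) (x : M.Γ) :
    M.tapeOf (l ++ x :: r) (l.length : ℤ) = x := by
  change ((l ++ x :: r)[l.length]?).getD M.blank = x
  simp

theorem update_tapeOf (l r : List M.Γ) (x y : M.Γ) :
    Function.update (M.tapeOf (l ++ x :: r)) (l.length : ℤ) y = M.tapeOf (l ++ y :: r) := by
  ext i
  by_cases hi : i = l.length
  · subst hi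
    simp [tapeOf_length]
  · rw [Function.update_of_ne hi]
    rcases i with n | n
    · have hn : n ≠ l.length := fun h => hi (by simp [h])
      simp only [tapeOf]
      congr 1
      rcases lt_or_gt_of_ne hn with h | h
      · rw [List.getElem?_append_left h, List.getElem?_append_left h]
      · rw [List.getElem?_append_right h.le, List.getElem?_append_right h.le]
        obtain ⟨k, hk⟩ := Nat.exists_eq_add_of_lt h
        have : n - l.length = k + 1 := by omega
        simp [this]
    · rfl

variable {M}

theorem step_of_tapeOf {x y : M.Γ} {D : Turing.Dir} (hx : x ∉ M.H) (hδ : M.δ ⟨x, hx⟩ = (y, D))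
    (l r : List M.Γ) :
    M.Step (M.headAfter l (x :: r)) ⟨M.tapeOf (l ++ y :: r), move l.length D⟩ := by
  have hcell : (M.headAfter l (x :: r)).tape (M.headAfter l (x :: r)).head = x :=
    M.tapeOf_length l r x
  have hδ' : ∀ h, M.δ ⟨(M.headAfter l (x :: r)).tape (M.headAfter l (x :: r)).head, h⟩ = (y, D) := by
    rw [hcell]
    exact fun _ => hδ
  refine ⟨by rwa [hcell], ?_⟩
  rw [hδ']
  simp only [headAfter, update_tapeOf]

theorem step_right {x y : M.Γ} (hx : x ∉ M.H) (hδ : M.δ ⟨x, hx⟩ = (y, .right))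
    (l r : List M.Γ) : M.Step (M.headAfter l (x :: r)) (M.headAfter (l ++ [y]) r) := by
  simpa [headAfter, move] using step_of_tapeOf hx hδ l r

theorem step_left {x y : M.Γ} (hx : x ∉ M.H) (hδ : M.δ ⟨x, hx⟩ = (y, .left))
    (l r : List M.Γ) : M.Step (M.headAfter l (x :: r)) (M.headBefore l (y :: r)) := by
  simpa [headBefore, move] using step_of_tapeOf hx hδ l r

theorem sweep_right {x y : M.Γ} (hx : x ∉ M.H) (hδ : M.δ ⟨x, hx⟩ = (y, .right)) (n : ℕ)
    (l r : List M.Γ) :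
    Relation.ReflTransGen M.Step (M.headAfter l (List.replicate n x ++ r))
      (M.headAfter (l ++ List.replicate n y) r) := by
  induction n generalizing l with
  | zero => simpa using .refl
  | succ n ih =>
    refine .head (step_right hx hδ l _) ?_
    simpa [List.replicate_succ] using ih (l ++ [y])

theorem sweep_left {x y : M.Γ} (hx : x ∉ M.H) (hδ : M.δ ⟨x, hx⟩ = (y, .left)) (n : ℕ)
    (l r : List M.Γ) :
    Relation.ReflTransGen M.Step (M.headBefore (l ++ List.replicate n x) r)
      (M.headBefore l (List.replicate n y ++ r)) := by
  induction n generalizing r with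
  | zero => simpa using .refl
  | succ n ih =>
    rw [List.replicate_succ', ← List.append_assoc, headBefore_concat]
    refine .head (step_left hx hδ _ _) ?_
    simpa [List.replicate_succ'] using ih (y :: r)

/-- A machine that halts on the empty word halts on the blank symbol. -/
theorem blank_mem_of_haltsOn_nil (h : M.HaltsOn []) : M.blank ∈ M.H := by
  by_contra hb
  rcases hδ : M.δ ⟨M.blank, hb⟩ with ⟨b, D⟩
  have hinit : ∀ i, (M.init []).tape i = M.blank := by
    rintro (n | n) <;> simp [init]
  have hcongr : ∀ (x : M.Γ) (hx : x ∉ M.H), x = M.blank → M.δ ⟨x, hx⟩ = (b, D) := by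
    rintro _ _ rfl
    exact hδ
  -- The head always moves in direction `D`, so the cell just written is left behind and everything
  -- ahead stays blank.
  let P : M.Cfg → Prop := fun c => match D with
    | .left => ∀ i ≤ c.head, c.tape i = M.blank
    | .right => ∀ i, c.head ≤ i → c.tape i = M.blank
  refine M.not_haltsOn_of_invariant (w := []) P ?_ ?_ .refl ?_ h
  · rintro c _ hP ⟨hc, rfl⟩
    cases D with
    | left =>
      rw [hcongr _ hc (hP _ le_rfl)]
      intro i hi
      simp only [move] at hi ⊢
      rw [Function.update_of_ne (by omega)]
      exact hP i (by omega)
    | right =>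
      rw [hcongr _ hc (hP _ le_rfl)]
      intro i hi
      simp only [move] at hi ⊢
      rw [Function.update_of_ne (by omega)]
      exact hP i (by omega)
  · intro c hP
    cases D <;> rwa [hP _ le_rfl]
  · cases D <;> exact fun i _ => hinit i

/-- If the blank is a halting symbol, then the machine halts on every one-letter word. -/
theorem haltsOn_singleton (hb : M.blank ∈ M.H) (s : S) : M.HaltsOn [s] := by
  by_cases hs : M.input s ∈ M.H
  · exact ⟨M.init [s], .refl, by simpa [init] using hs⟩
  · rcases hδ : M.δ ⟨M.input s, hs⟩ with ⟨y, D⟩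
    rw [HaltsOn, init_eq_headAfter]
    refine ⟨_, .single (step_of_tapeOf hs hδ [] []), ?_⟩
    cases D with
    | left => exact hb
    | right => simpa [move, tapeOf] using hb

end General

end OneStateTM

/-! ### A regular language outside the one-state class -/

/-- The words of even length over a one-letter alphabet. -/
def evenLength : FormalLanguage where
  alphabet := Unit
  words := {w | Even w.length}

theorem evenLength_mem_classR : evenLength ∈ classR := by
  let A : DFA Unit Bool := ⟨fun b _ => !b, true, {true}⟩
  have hA : ∀ (w : List Unit) (b : Bool), A.evalFrom b w = (b ^^ decide (¬ Even w.length)) := by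
    intro w
    induction w with
    | nil => simp
    | cons s w ih =>
      intro b
      have : A.evalFrom b (s :: w) = A.evalFrom (!b) w := rfl
      rw [this, ih]
      by_cases hw : Even w.length <;> simp [hw, Nat.even_add_one]
  refine ⟨Bool, inferInstance, A, ?_⟩
  ext w
  change A.evalFrom true w = true ↔ Even (List.length (α := Unit) w)
  rw [hA w true]
  by_cases hw : Even (List.length (α := Unit) w) <;> simp [hw]

theorem evenLength_notMem_classTM1state : evenLength ∉ classTM1state := by
  rintro ⟨M, hM⟩
  have hnil : M.HaltsOn [] := by
    change [] ∈ M.language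
    rw [hM]
    exact Even.zero
  have hone : [()] ∈ M.language :=
    OneStateTM.haltsOn_singleton (OneStateTM.blank_mem_of_haltsOn_nil hnil) ()
  rw [hM] at hone
  exact absurd (show Even 1 from hone) (by decide)

/-! ### The binary counter machine -/

/-- The input letters of the counter machine. -/
inductive CounterLetter
  | digit | unit | marker
  deriving DecidableEq

instance : Fintype CounterLetter where
  elems := {.digit, .unit, .marker}
  complete := by rintro (_ | _ | _) <;> simp

/-- The tape symbols of the counter machine. A cell that holds a binary digit is `passed` while the
head is on its left; a unit is `used` or not. -/
inductive CounterSymbol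
  | blank | passed | zero | one | unit | used | marker
  deriving DecidableEq

instance : Fintype CounterSymbol where
  elems := {.blank, .passed, .zero, .one, .unit, .used, .marker}
  complete := by rintro (_ | _ | _ | _ | _ | _ | _) <;> simp

open CounterLetter in
/-- On the word `digit ^ n ++ unit ^ m ++ marker`, this machine increments an `n`-digit binary counter
once per unit. It halts at `marker` if the units are exhausted, and leaves to the left forever if the
counter overflows. -/
def counterTM : OneStateTM CounterLetter where
  Γ := CounterSymbol
  blank := .blank
  input := ⟨fun
    | digit => .passed
    | unit => .unit
    | marker => .marker, by rintro (_ | _ | _) (_ | _ | _) <;> simp⟩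
  input_ne_blank := by rintro (_ | _ | _) <;> simp
  H := {.marker}
  δ x := match x.1 with
    | .blank => (.blank, .left)
    | .passed => (.zero, .right)
    | .zero => (.one, .right)
    | .one => (.passed, .left)
    | .unit => (.used, .left)
    | .used => (.unit, .right)
    | .marker => (.marker, .right)

namespace counterTM

open OneStateTM List

/-- The word `digit ^ n ++ unit ^ m ++ marker`. -/
def word (n m : ℕ) : List CounterLetter :=
  replicate n .digit ++ (replicate m .unit ++ [.marker])

/-- A symbol, seen as a tape symbol of the machine. -/
def sym (x : CounterSymbol) : counterTM.Γ := x

/-- The units and the marker symbol, after `j` of the units have been used. -/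
def units (m j : ℕ) : List counterTM.Γ :=
  replicate j (sym .used) ++ (replicate (m - j) (sym .unit) ++ [sym .marker])

theorem notMem_H {x : CounterSymbol} (h : x ≠ .marker) : sym x ∉ counterTM.H := h

theorem init_reaches (n m : ℕ) : Relation.ReflTransGen counterTM.Step
    (counterTM.init (word n m))
    (counterTM.headAfter (replicate n (sym .zero)) (units m 0)) := by
  have h := sweep_right (M := counterTM) (x := sym .passed) (y := sym .zero)
    (notMem_H (by simp)) rfl n [] (units m 0)
  rw [init_eq_headAfter]
  simp only [word, map_append, map_replicate, map_cons, map_nil]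
  exact h

/-- One unit is used up, and the head returns to the last digit. -/
theorem use_unit {m j : ℕ} (hj : j < m) (l : List counterTM.Γ) :
    Relation.ReflTransGen counterTM.Step (counterTM.headAfter l (units m j))
      (counterTM.headBefore l (units m (j + 1))) := by
  obtain ⟨k, rfl⟩ := Nat.exists_eq_add_of_lt hj
  -- The outward sweep turns used units back into units, up to the first fresh one; the sweep back
  -- marks them all as used.
  have h1 := sweep_right (M := counterTM) (x := sym .used) (y := sym .unit)
    (notMem_H (by simp)) rfl j l (replicate (k + 1) (sym .unit) ++ [sym .marker])
  have h2 := step_left (M := counterTM) (x := sym .unit) (y := sym .used)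
    (notMem_H (by simp)) rfl (l ++ replicate j (sym .unit))
    (replicate k (sym .unit) ++ [sym .marker])
  have h3 := sweep_left (M := counterTM) (x := sym .unit) (y := sym .used)
    (notMem_H (by simp)) rfl j l
    (sym .used :: (replicate k (sym .unit) ++ [sym .marker]))
  have e1 : j + k + 1 - j = k + 1 := by omega
  have e2 : j + k + 1 - (j + 1) = k := by omega
  have e3 : units (j + k + 1) (j + 1) = replicate j (sym .used) ++
      (sym .used :: (replicate k (sym .unit) ++ [sym .marker])) := by
    rw [units, e2, replicate_succ', append_assoc]
    rfl
  rw [e3, units, e1]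
  exact h1.trans (.head h2 h3)

/-- The last digit is the least significant. The lower `n` digits count to all ones, the next
increment carries into the leading zero and clears them, and they count up again: `(2 ^ n - 1) + 1 +
(2 ^ n - 1)` units. -/
theorem count_up {m : ℕ} (n : ℕ) (l : List counterTM.Γ) {j : ℕ} (hj : j + 2 ^ n ≤ m + 1) :
    Relation.ReflTransGen counterTM.Step
      (counterTM.headAfter (l ++ replicate n (sym .zero)) (units m j))
      (counterTM.headAfter (l ++ replicate n (sym .one)) (units m (j + (2 ^ n - 1)))) := by
  induction n generalizing l j with
  | zero => simpa using .refl
  | succ n ih =>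
    have hpos := Nat.two_pow_pos n
    rw [pow_succ] at hj ⊢
    have h1 := ih (l ++ [sym .zero]) (j := j) (by omega)
    have h2 := use_unit (m := m) (j := j + (2 ^ n - 1)) (by omega)
      (l ++ [sym .zero] ++ replicate n (sym .one))
    have h3 := sweep_left (M := counterTM) (x := sym .one) (y := sym .passed)
      (notMem_H (by simp)) rfl n (l ++ [sym .zero]) (units m (j + (2 ^ n - 1) + 1))
    rw [headBefore_concat] at h3
    have h4 := step_right (M := counterTM) (x := sym .zero) (y := sym .one)
      (notMem_H (by simp)) rfl l
      (replicate n (sym .passed) ++ units m (j + (2 ^ n - 1) + 1))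
    have h5 := sweep_right (M := counterTM) (x := sym .passed) (y := sym .zero)
      (notMem_H (by simp)) rfl n (l ++ [sym .one]) (units m (j + (2 ^ n - 1) + 1))
    have h6 := ih (l ++ [sym .one]) (j := j + (2 ^ n - 1) + 1) (by omega)
    have e : j + (2 ^ n - 1) + 1 + (2 ^ n - 1) = j + (2 ^ n * 2 - 1) := by omega
    rw [e] at h6
    have h := (h1.trans (h2.trans h3)).trans (.head h4 (h5.trans h6))
    simpa [replicate_succ] using h

theorem init_reaches_ones {n m : ℕ} (hm : 2 ^ n ≤ m + 1) : Relation.ReflTransGen counterTM.Step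
    (counterTM.init (word n m))
    (counterTM.headAfter (replicate n (sym .one)) (units m (2 ^ n - 1))) := by
  have h := count_up n [] (j := 0) (by omega : 0 + 2 ^ n ≤ m + 1)
  rw [zero_add] at h
  exact (init_reaches n m).trans h

theorem word_mem_language (n : ℕ) : word n (2 ^ n - 1) ∈ counterTM.language := by
  have hpos := Nat.two_pow_pos n
  have h := init_reaches_ones (n := n) (m := 2 ^ n - 1) (by omega)
  have h' := sweep_right (M := counterTM) (x := sym .used) (y := sym .unit)
    (notMem_H (by simp)) rfl (2 ^ n - 1) (replicate n (sym .one)) [sym .marker]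
  rw [units, Nat.sub_self] at h
  refine ⟨_, h.trans h', ?_⟩
  simp only [headAfter, tapeOf_length]
  rfl

theorem word_notMem_language {n m : ℕ} (hm : 2 ^ n ≤ m) : word n m ∉ counterTM.language := by
  have hpos := Nat.two_pow_pos n
  have h1 := init_reaches_ones (n := n) (m := m) (by omega)
  have h2 := use_unit (m := m) (j := 2 ^ n - 1) (by omega) (replicate n (sym .one))
  -- The carry passes every digit, so the head falls off at cell `-1`, into the blanks.
  have h3 := sweep_left (M := counterTM) (x := sym .one) (y := sym .passed)
    (notMem_H (by simp)) rfl n [] (units m (2 ^ n - 1 + 1))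
  refine not_haltsOn_of_invariant counterTM
    (fun c => c.head < 0 ∧ ∀ i < 0, c.tape i = sym .blank) ?_ ?_
    (h1.trans (h2.trans h3)) ?_
  · rintro ⟨t, i⟩ _ ⟨hi, ht⟩ ⟨hx, rfl⟩
    have hti := ht i hi
    have hδ : counterTM.δ ⟨t i, hx⟩ = (sym .blank, .left) := by
      simp only at hti
      simp only [counterTM, hti]
      rfl
    simp only [hδ, move]
    simp only at hi
    refine ⟨by omega, fun k hk => ?_⟩
    by_cases hki : k = i
    · rw [hki, Function.update_self]
    · rw [Function.update_of_ne hki]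
      exact ht k hk
  · rintro c ⟨hc, ht⟩
    rw [ht _ hc]
    exact notMem_H (by simp)
  · refine ⟨by simp [headBefore], ?_⟩
    rintro (k | k) hk
    · simp at hk
      omega
    · rfl

/-- The only halting symbol is never written on a tape that lacks it. Hence pumping down cannot
delete the marker. -/
theorem notMem_language_of_marker_notMem {w : List CounterLetter} (hw : .marker ∉ w) :
    w ∉ counterTM.language := by
  refine not_haltsOn_of_invariant counterTM
    (fun c => ∀ i, c.tape i ≠ sym .marker) ?_ (fun c hc => hc _) .refl ?_
  · rintro c _ hc ⟨hx, rfl⟩ i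
    by_cases hi : i = c.head
    · have hδ : ∀ y : {a : counterTM.Γ // a ∉ counterTM.H},
          (counterTM.δ y).1 ≠ sym .marker := by
        rintro ⟨_ | _ | _ | _ | _ | _ | _, hy⟩ <;>
          first
          | exact absurd rfl hy
          | exact CounterSymbol.noConfusion
      simpa [hi] using hδ _
    · simpa [hi] using hc i
  · rintro (i | i)
    · change (w[i]?).elim (sym .blank) counterTM.input ≠ sym .marker
      rcases h : w[i]? with _ | x
      · exact CounterSymbol.noConfusion
      · have hx : x ∈ w := mem_of_getElem? h
        cases x with
        | marker => exact absurd hx hw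
        | digit | unit => exact CounterSymbol.noConfusion
    · exact CounterSymbol.noConfusion

theorem word_insert_unit {n m : ℕ} {p q : List CounterLetter} (h : word n m = p ++ .unit :: q)
    (k : ℕ) : word n (m + k) = p ++ (replicate k .unit ++ .unit :: q) := by
  induction n generalizing p with
  | succ n ih =>
    rcases p with _ | ⟨x, p⟩
    · simp [word, replicate_succ] at h
    · simp only [word, replicate_succ, cons_append, cons.injEq] at h ⊢
      exact ⟨h.1, ih h.2⟩
  | zero =>
    induction m generalizing p with
    | zero =>
      rcases p with _ | ⟨x, p⟩ <;> simp [word] at h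
    | succ m ih =>
      rcases p with _ | ⟨x, p⟩
      · simp only [word, replicate_succ, replicate_zero, nil_append, cons_append, cons.injEq,
          true_and] at h
        subst h
        rw [show m + 1 + k = k + (m + 1) by omega]
        simp [word, replicate_add, replicate_succ]
      · rw [show m + 1 + k = m + k + 1 by omega]
        simp only [word, replicate_succ, replicate_zero, nil_append, cons_append,
          cons.injEq] at h ih ⊢
        exact ⟨h.1, ih h.2⟩

theorem word_pump_units {n m s : ℕ} {p q : List CounterLetter}
    (h : word n m = p ++ replicate s .unit ++ q) :
    word n (m + s) = p ++ (replicate s .unit ++ replicate s .unit) ++ q := by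
  cases s with
  | zero => simpa using h
  | succ s =>
    rw [replicate_succ, append_assoc, cons_append] at h
    have := word_insert_unit h (s + 1)
    simpa [replicate_succ] using this

/-- Applied to the pumped-down word, a sublist of the original. -/
theorem eq_word_of_sublist {n m : ℕ} {w : List CounterLetter} (h : w <+ word n m)
    (hs : .marker ∈ w) : ∃ n' m', n' = w.count .digit ∧ m' + n' + 1 = w.length ∧ w = word n' m' := by
  obtain ⟨l1, l2, rfl, h1, h2⟩ := sublist_append_iff.1 h
  obtain ⟨l3, l4, rfl, h3, h4⟩ := sublist_append_iff.1 h2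
  obtain ⟨n', -, rfl⟩ := sublist_replicate_iff.1 h1
  obtain ⟨m', -, rfl⟩ := sublist_replicate_iff.1 h3
  rcases sublist_singleton.1 h4 with rfl | rfl
  · simp at hs
  · exact ⟨n', m', by simp [count_replicate], by simp; omega, rfl⟩

theorem not_isContextFree : ¬ counterTM.language.IsContextFree := by
  intro hL
  obtain ⟨K, hK⟩ := hL.pumping
  have hlt : K < 2 ^ K := Nat.lt_two_pow_self
  obtain ⟨n, hn⟩ : ∃ n, n = K + 1 := ⟨_, rfl⟩
  have hpow : 2 ^ n = 2 ^ K * 2 := by rw [hn, pow_succ]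
  obtain ⟨u, v, x, y, z, hw, hvy, hlen, hpump⟩ :=
    hK (word n (2 ^ n - 1)) (word_mem_language n) (by simp [word]; omega)
  have h0 := hpump 0
  simp only [replicate_zero, flatten_nil, append_nil] at h0
  have hsub : u ++ x ++ z <+ word n (2 ^ n - 1) := by
    rw [hw]
    simp
  have hmarker : .marker ∈ u ++ x ++ z := by
    by_contra h
    exact notMem_language_of_marker_notMem h h0
  obtain ⟨n', m', hn', hm', hword⟩ := eq_word_of_sublist hsub hmarker
  have hcount (t : CounterLetter) := congrArg (count t) hw
  simp only [count_append] at hcount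
  have hlength := congrArg length hw
  have hcn : count .digit (word n (2 ^ n - 1)) = n := by simp [word, count_replicate]
  have hcs : count .marker (word n (2 ^ n - 1)) = 1 := by simp [word, count_replicate]
  have hwl : (word n (2 ^ n - 1)).length = n + (2 ^ n - 1) + 1 := by simp [word]; omega
  have h1 := hcount .digit
  have h2 := hcount .marker
  have h3 := count_pos_iff.2 hmarker
  simp only [count_append, length_append] at hn' h3 hlen hlength hm'
  rcases Nat.eq_zero_or_pos (count .digit v + count .digit y) with hd | hd
  · have hunit : ∀ l : List CounterLetter, count .digit l = 0 → count .marker l = 0 →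
        l = replicate l.length .unit := by
      intro l hl hl'
      rw [eq_replicate_iff]
      refine ⟨rfl, fun t ht => ?_⟩
      cases t with
      | unit => rfl
      | digit => exact absurd ht (count_eq_zero.1 hl)
      | marker => exact absurd ht (count_eq_zero.1 hl')
    -- The single marker survives in `u ++ x ++ z`, so `v` and `y` consist of units and pumping up
    -- overflows the counter.
    have hv := hunit v (by omega) (by omega)
    have hy := hunit y (by omega) (by omega)
    have hvy' : 0 < v.length + y.length := by
      rw [← length_append]
      exact length_pos_iff.2 hvy
    have hup := hpump 2
    generalize v.length = s at *
    generalize y.length = t at *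
    subst hv hy
    have e1 := word_pump_units (p := u) (q := x ++ replicate t .unit ++ z)
      (by simpa using hw)
    have e2 := word_pump_units (s := t) (p := u ++ (replicate s .unit ++ replicate s .unit) ++ x)
      (q := z) (by simpa using e1)
    refine word_notMem_language (n := n) (m := 2 ^ n - 1 + s + t) (by omega) ?_
    rw [e2]
    simpa [replicate_succ] using hup
  · rw [hword] at h0
    refine word_notMem_language ?_ h0
    -- A digit is lost, so `n' ≤ K`. At most `K` letters are removed, so `m' ≥ 2 ^ n - 1 - K = 2 * 2
    -- ^ K - 1 - K ≥ 2 ^ K`.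
    have : 2 ^ n' ≤ 2 ^ K := Nat.pow_le_pow_right (by omega) (by omega)
    omega

end counterTM

theorem mainTheorem2 : ¬ classR ⊆ classTM1state ∧ ¬ classTM1state ⊆ classCF := by
  refine ⟨fun h => evenLength_notMem_classTM1state (h evenLength_mem_classR), fun h => ?_⟩
  exact counterTM.not_isContextFree
    (h (show (⟨CounterLetter, counterTM.language⟩ : FormalLanguage) ∈ classTM1state from
      ⟨counterTM, rfl⟩))
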